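/- Let $K$ be a field and $S = K[x_1,\dots,x_n]$, $\mathbb{Z}^n$-graded by $\deg x_i = \varepsilon_i$ (the $i$-th unit vector). For a finitely generated $\mathbb{Z}^n$-graded $S$-module $M = \bigoplus_{a \in \mathbb{Z}^n} M_a$ consider the induced $\mathbb{Z}$-grading $M_j = \bigoplus_{|a| = j} M_a$, where $|a| = a_1 + \dots + a_n$, and the graded Betti numbers $\beta_{i,j}(M) = \dim_K \operatorname{Tor}_i^S(M,K)_j$, computed from any $\mathbb{Z}$-graded free resolution of $M$ by free modules of finite rank. If $M \neq 0$, let $d = \min\{j : M_j \neq 0\}$ be its initial degree and put $\beta_i^{\mathrm{lin}}(M) = \beta_{i,i+d}(M)$; for $M = 0$ put $\beta_i^{\mathrm{lin}}(M) = 0$. Let $N$ be a finitely generated $\mathbb{Z}^n$-graded $S$-module, let $$\cdots \to F_2 \to F_1 \to F_0 \to N \to 0$$ be a minimal $\mathbb{Z}^n$-graded free resolution of $N$ (that is, an exact complex with maps homogeneous of degree $0$, with all $F_i$ graded free of finite rank, such that the image of $F_{i+1} \to F_i$ lies in $(x_1,\dots,x_n)F_i$ for all $i \geq 0$), let $k \geq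 0$, and let $M$ be a finitely generated $\mathbb{Z}^n$-graded $S$-module that is isomorphic, as a graded module, to the $k$-th syzygy module of this resolution: $N$ itself if $k = 0$, and the image of $F_k \to F_{k-1}$ if $k \geq 1$. If $\beta_p^{\mathrm{lin}}(M) \neq 0$ for some integer $p \geq 0$, then $$\beta_i^{\mathrm{lin}}(M) \geq \binom{p+k}{i+k} \qquad \text{for } i = 0, \dots, p.$$ -/

import Mathlib

open MvPolynomial

namespace LinearStrand

/-- The degrees of the variables in the `ℤⁿ`-grading of `K[x₁, …, xₙ]`: `deg xᵢ = εᵢ`. -/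
def fineWeight (n : ℕ) : Fin n → (Fin n → ℤ) := fun i => Pi.single i 1

/-- The degrees of the variables in the standard `ℤ`-grading of `K[x₁, …, xₙ]`: `deg xᵢ = 1`. -/
def stdWeight (n : ℕ) : Fin n → ℤ := fun _ => 1

/-- The `ℤ`-grading `M_d = ⨁_{|a| = d} M_a` of a `ℤⁿ`-graded module. -/
def coarsening {K M : Type*} [Field K] [AddCommGroup M] [Module K M] {n : ℕ}
    (𝓜 : (Fin n → ℤ) → Submodule K M) : ℤ → Submodule K M :=
  fun d => ⨆ (a : Fin n → ℤ) (_ : ∑ i, a i = d), 𝓜 a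

/-- The initial degree of a `ℤ`-graded module: the least `d` with `M_d ≠ 0`. -/
noncomputable def initialDegree {K M : Type*} [Field K] [AddCommGroup M] [Module K M]
    (𝓜 : ℤ → Submodule K M) : ℤ :=
  sInf {d : ℤ | 𝓜 d ≠ ⊥}

/-- The component of degree `a` of the graded free module `⨁ₗ S(-deg l)` with `S = K[x₁, …, xₙ]`,
whose `l`-th basis vector has degree `deg l`. The variables have the degrees `w`. -/
noncomputable def freePart {K Γ : Type*} [Field K] [AddCommGroup Γ] {n r : ℕ}
    (w : Fin n → Γ) (deg : Fin r → Γ) (a : Γ) : Submodule K (Fin r → MvPolynomial (Fin n) K) :=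
  Submodule.pi Set.univ fun l => weightedHomogeneousSubmodule K w (a - deg l)

/-- A graded free resolution `⋯ → F₂ → F₁ → F₀ → M → 0` of a graded module `M` over
`S = K[x₁, …, xₙ]` by graded free modules of finite rank. The grading group is `Γ`, the variables
have the degrees `w`, and all maps are homogeneous of degree `0`. -/
structure GradedFreeResolution {K M Γ : Type*} [Field K] [AddCommGroup Γ] {n : ℕ}
    [AddCommGroup M] [Module K M] [Module (MvPolynomial (Fin n) K) M]
    (w : Fin n → Γ) (𝓜 : Γ → Submodule K M) where
  /-- The rank of `Fᵢ`. -/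
  rank : ℕ → ℕ
  /-- The degrees of the basis vectors of `Fᵢ`. -/
  deg : ∀ i, Fin (rank i) → Γ
  /-- The differential `Fᵢ₊₁ → Fᵢ`. -/
  d : ∀ i, (Fin (rank (i + 1)) → MvPolynomial (Fin n) K) →ₗ[MvPolynomial (Fin n) K]
    (Fin (rank i) → MvPolynomial (Fin n) K)
  /-- The augmentation `F₀ → M`. -/
  aug : (Fin (rank 0) → MvPolynomial (Fin n) K) →ₗ[MvPolynomial (Fin n) K] M
  d_mem : ∀ i a, ∀ f ∈ freePart w (deg (i + 1)) a, d i f ∈ freePart w (deg i) a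
  aug_mem : ∀ a, ∀ f ∈ freePart w (deg 0) a, aug f ∈ 𝓜 a
  aug_surjective : Function.Surjective aug
  exact_zero : Function.Exact (d 0) aug
  exact_succ : ∀ i, Function.Exact (d (i + 1)) (d i)

namespace GradedFreeResolution

variable {K M Γ : Type*} [Field K] [AddCommGroup Γ] {n : ℕ}
  [AddCommGroup M] [Module K M] [Module (MvPolynomial (Fin n) K) M]
  {w : Fin n → Γ} {𝓜 : Γ → Submodule K M}

/-- The resolution is minimal: `d(Fᵢ₊₁) ⊆ 𝔪 Fᵢ` for all `i ≥ 0`, where `𝔪 = (x₁, …, xₙ)`. -/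
def IsMinimal (F : GradedFreeResolution w 𝓜) : Prop :=
  ∀ i, LinearMap.range (F.d i) ≤
    Ideal.span (Set.range (X : Fin n → MvPolynomial (Fin n) K)) •
      (⊤ : Submodule (MvPolynomial (Fin n) K) (Fin (F.rank i) → MvPolynomial (Fin n) K))

/-- `F.IsSyzygy 𝓛 k`: the graded module `L` is isomorphic, as a graded module, to the `k`-th syzygy
module of the resolution `F` of `M`. This is `M` for `k = 0`, and the image of
`Fₖ → Fₖ₋₁`, with the grading of a submodule of `Fₖ₋₁`, for `k ≥ 1`. -/
def IsSyzygy {L : Type*} [AddCommGroup L] [Module K L] [Module (MvPolynomial (Fin n) K) L]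
    (F : GradedFreeResolution w 𝓜) (𝓛 : Γ → Submodule K L) : ℕ → Prop
  | 0 => ∃ φ : L →ₗ[MvPolynomial (Fin n) K] M,
      Function.Bijective φ ∧ ∀ a x, x ∈ 𝓛 a ↔ φ x ∈ 𝓜 a
  | k + 1 => ∃ φ : L →ₗ[MvPolynomial (Fin n) K] (Fin (F.rank k) → MvPolynomial (Fin n) K),
      Function.Injective φ ∧ LinearMap.range φ = LinearMap.range (F.d k) ∧
        ∀ a x, x ∈ 𝓛 a ↔ φ x ∈ freePart w (F.deg k) a

/-- The differential of `F ⊗_S K`, where `K = S / (x₁, …, xₙ)`. Here `Fᵢ ⊗_S K` is `K ^ rank i`, and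
the matrix of the differential is that of `F` with the entries replaced by their constant
coefficients. -/
noncomputable def dBar (F : GradedFreeResolution w 𝓜) (i : ℕ) :
    (Fin (F.rank (i + 1)) → K) →ₗ[K] (Fin (F.rank i) → K) :=
  Matrix.toLin' ((LinearMap.toMatrix' (F.d i)).map constantCoeff)

/-- The cycles of `F ⊗_S K` in homological degree `i`. -/
noncomputable def cycles (F : GradedFreeResolution w 𝓜) :
    ∀ i, Submodule K (Fin (F.rank i) → K)
  | 0 => ⊤
  | i + 1 => LinearMap.ker (F.dBar i)

/-- The boundaries of `F ⊗_S K` in homological degree `i`. -/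
noncomputable def boundaries (F : GradedFreeResolution w 𝓜) (i : ℕ) :
    Submodule K (Fin (F.rank i) → K) :=
  LinearMap.range (F.dBar i)

/-- The component of degree `a` of `Fᵢ ⊗_S K`: the vectors supported on the basis vectors of
degree `a`. -/
def barPart (F : GradedFreeResolution w 𝓜) (i : ℕ) (a : Γ) :
    Submodule K (Fin (F.rank i) → K) where
  carrier := {v | ∀ l, F.deg i l ≠ a → v l = 0}
  add_mem' hv hu l hl := by simp [hv l hl, hu l hl]
  zero_mem' _ _ := rfl
  smul_mem' c v hv l hl := by simp [hv l hl]

/-- `Tor_i(M, K)_a`, computed from the graded free resolution `F` of `M`: the component of degree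
`a` of the homology `H_i(F ⊗_S K)`. -/
abbrev Tor (F : GradedFreeResolution w 𝓜) (i : ℕ) (a : Γ) : Type _ :=
  ↥(F.cycles i ⊓ F.barPart i a) ⧸
    (F.boundaries i ⊓ F.barPart i a).submoduleOf (F.cycles i ⊓ F.barPart i a)

/-- The graded Betti number `β_{i,a}(M) = dim_K Tor_i(M, K)_a`. -/
noncomputable def betti (F : GradedFreeResolution w 𝓜) (i : ℕ) (a : Γ) : ℕ :=
  Module.finrank K (F.Tor i a)

/-- `β_i^lin(M) = β_{i,i+d}(M)`, where `d` is the initial degree of the `ℤ`-graded module `M`. -/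
noncomputable def linBetti {𝓜 : ℤ → Submodule K M}
    (F : GradedFreeResolution (stdWeight n) 𝓜) (i : ℕ) : ℕ :=
  F.betti i (i + initialDegree 𝓜)

end GradedFreeResolution

end LinearStrand

/-! The Betti numbers of `M` are read off from the tail of `F` from `Fₖ` on, which is a minimal
resolution of `M`. Homological degree `i` over `M` is degree `k + i` over `N`; this shift is where
`k` enters the binomial.

Let `e` be a basis vector of `Fᵢ₊₁`, of multidegree `b`, with `|b|` at most one above every total
degree in `Fᵢ`. By minimality the entries of `d e` are scalar multiples of variables, and `x_v`
occurs only if `b - ε_v` is a degree of `Fᵢ`. Let `J` be the set of `v` for which it is one. If `|J|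
≤ i`, then `Tor_{i+1}(N, S/(x_v : v ∈ J)) = 0`, so `e` is a boundary modulo these variables, against
minimality. Hence `|J| ≥ i + 1` (`lt_card_neighbours`).

Now start from a multidegree `a` on the linear strand in degree `k + p` and descend by unit vectors.
After `j` steps each multidegree reached has at least `p + k - j` lower neighbours. A multidegree `c
≤ a` at level `j + 1` has at most `j + 1` upper neighbours below `a`, since `|a - c| = j + 1`.
Double counting gives at least `(p + k).choose j` distinct multidegrees at level `j`
(`choose_le_card_of_neighbours`). The claim is the case `j = p - i`. -/

namespace LinearStrand

/-! ### Graded free modules and homogeneous lifts -/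

section Graded

variable {K Γ : Type*} [Field K] [AddCommGroup Γ] {n r s : ℕ} {w : Fin n → Γ}
  {deg : Fin r → Γ} {deg' : Fin s → Γ}

theorem mem_freePart {a : Γ} {f : Fin r → MvPolynomial (Fin n) K} :
    f ∈ freePart w deg a ↔ ∀ l, IsWeightedHomogeneous w (f l) (a - deg l) := by
  simp [freePart, Submodule.mem_pi]

theorem smul_mem_freePart {a c : Γ} {q : MvPolynomial (Fin n) K}
    {f : Fin r → MvPolynomial (Fin n) K} (hq : IsWeightedHomogeneous w q c)
    (hf : f ∈ freePart w deg a) : q • f ∈ freePart w deg (c + a) := by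
  rw [mem_freePart] at hf ⊢
  intro l
  rw [add_sub_assoc]
  exact hq.mul (hf l)

theorem single_mem_freePart (l : Fin r) :
    (Pi.single l 1 : Fin r → MvPolynomial (Fin n) K) ∈ freePart w deg (deg l) := by
  rw [mem_freePart]
  intro l'
  by_cases h : l' = l
  · subst h
    simpa using isWeightedHomogeneous_one K w
  · simpa [Pi.single_eq_of_ne h] using isWeightedHomogeneous_zero K w (deg l - deg l')

/-- The projection of a graded free module onto its component of degree `a`. -/
noncomputable def freeProj (w : Fin n → Γ) (deg : Fin r → Γ) (a : Γ) :
    (Fin r → MvPolynomial (Fin n) K) →ₗ[K] (Fin r → MvPolynomial (Fin n) K) :=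
  LinearMap.pi fun l => weightedHomogeneousComponent w (a - deg l) ∘ₗ LinearMap.proj l

theorem freeProj_mem (a : Γ) (f : Fin r → MvPolynomial (Fin n) K) :
    freeProj w deg a f ∈ freePart w deg a :=
  mem_freePart.2 fun _ => weightedHomogeneousComponent_isWeightedHomogeneous _ _

theorem freeProj_of_mem {a : Γ} {f : Fin r → MvPolynomial (Fin n) K}
    (hf : f ∈ freePart w deg a) : freeProj w deg a f = f := by
  funext l
  exact (mem_freePart.1 hf l).weightedHomogeneousComponent_same

theorem freeProj_of_mem_ne {a b : Γ} (hab : a ≠ b) {f : Fin r → MvPolynomial (Fin n) K}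
    (hf : f ∈ freePart w deg b) : freeProj w deg a f = 0 := by
  funext l
  exact (mem_freePart.1 hf l).weightedHomogeneousComponent_ne _ fun h =>
    hab (sub_left_injective h)

/-- The family `𝓛` of subspaces admits projections, each of which kills the other subspaces. -/
def HasProjections {L : Type*} [AddCommGroup L] [Module K L] (𝓛 : Γ → Submodule K L) : Prop :=
  ∃ π : Γ → L →ₗ[K] L, (∀ a, ∀ x ∈ 𝓛 a, π a x = x) ∧ ∀ a b, a ≠ b → ∀ x ∈ 𝓛 b, π a x = 0

theorem hasProjections_freePart :
    HasProjections (freePart w deg : Γ → Submodule K (Fin r → MvPolynomial (Fin n) K)) :=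
  ⟨freeProj w deg, fun _ _ h => freeProj_of_mem h, fun _ _ hab _ h => freeProj_of_mem_ne hab h⟩

variable {L : Type*} [AddCommGroup L] [Module K L] {𝓛 : Γ → Submodule K L}

theorem exists_homogeneous_preimage (h𝓛 : HasProjections 𝓛)
    {ψ : (Fin r → MvPolynomial (Fin n) K) →ₗ[K] L}
    (hψ : ∀ a, ∀ f ∈ freePart w deg a, ψ f ∈ 𝓛 a) {a : Γ} {x : L} (hx : x ∈ 𝓛 a)
    (hr : ∃ f, ψ f = x) : ∃ f ∈ freePart w deg a, ψ f = x := by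
  obtain ⟨π, h1, h0⟩ := h𝓛
  obtain ⟨f, rfl⟩ := hr
  -- Both sides are `K`-linear, so monomial multiples of basis vectors suffice, and these are
  -- homogeneous.
  have key : ψ ∘ₗ freeProj w deg a = π a ∘ₗ ψ := by
    refine LinearMap.pi_ext' fun l => MvPolynomial.linearMap_ext fun m => LinearMap.ext_ring ?_
    have hm : (Pi.single l (monomial m 1) : Fin r → MvPolynomial (Fin n) K) ∈
        freePart w deg (Finsupp.weight w m + deg l) := by
      have := smul_mem_freePart (isWeightedHomogeneous_monomial w m (1 : K) rfl)
        (single_mem_freePart (K := K) (w := w) (deg := deg) l)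
      rwa [← Pi.single_smul, smul_eq_mul, mul_one] at this
    change ψ (freeProj w deg a (Pi.single l (monomial m 1))) =
      π a (ψ (Pi.single l (monomial m 1)))
    by_cases hab : a = Finsupp.weight w m + deg l
    · rw [← hab] at hm
      rw [freeProj_of_mem hm, h1 _ _ (hψ _ _ hm)]
    · rw [freeProj_of_mem_ne hab hm, h0 _ _ hab _ (hψ _ _ hm), map_zero]
  refine ⟨freeProj w deg a f, freeProj_mem a f, ?_⟩
  rw [← h1 _ _ hx]
  exact LinearMap.congr_fun key f

variable [Module (MvPolynomial (Fin n) K) L]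

theorem linearMap_mem_of_single
    (hsmul : ∀ (c a : Γ) (q : MvPolynomial (Fin n) K), IsWeightedHomogeneous w q c →
      ∀ x ∈ 𝓛 a, q • x ∈ 𝓛 (c + a))
    {θ : (Fin r → MvPolynomial (Fin n) K) →ₗ[MvPolynomial (Fin n) K] L}
    (hθ : ∀ l, θ (Pi.single l 1) ∈ 𝓛 (deg l)) (a : Γ) (f : Fin r → MvPolynomial (Fin n) K)
    (hf : f ∈ freePart w deg a) : θ f ∈ 𝓛 a := by
  rw [LinearMap.pi_apply_eq_sum_univ θ f]
  refine Submodule.sum_mem _ fun l _ => ?_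
  have := hsmul _ _ _ (mem_freePart.1 hf l) _ (hθ l)
  rw [sub_add_cancel] at this
  convert this using 3
  funext j
  simp [Pi.single_apply, eq_comm]

/-- A homogeneous map of degree `0` between graded free modules. -/
def IsGraded (w : Fin n → Γ) (deg : Fin r → Γ) (deg' : Fin s → Γ)
    (φ : (Fin r → MvPolynomial (Fin n) K) →ₗ[MvPolynomial (Fin n) K]
      (Fin s → MvPolynomial (Fin n) K)) : Prop :=
  ∀ a, ∀ f ∈ freePart w deg a, φ f ∈ freePart w deg' a

/-- Projectivity in degree-preserving form: the image of each basis vector is homogeneous, so it has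
a homogeneous preimage of the same degree. -/
theorem exists_graded_lift [IsScalarTower K (MvPolynomial (Fin n) K) L]
    (h𝓛 : HasProjections 𝓛)
    {ψ : (Fin s → MvPolynomial (Fin n) K) →ₗ[MvPolynomial (Fin n) K] L}
    (hψ : ∀ a, ∀ f ∈ freePart w deg' a, ψ f ∈ 𝓛 a)
    {θ : (Fin r → MvPolynomial (Fin n) K) →ₗ[MvPolynomial (Fin n) K] L}
    (hθ : ∀ a, ∀ f ∈ freePart w deg a, θ f ∈ 𝓛 a) (hr : ∀ x, ∃ y, ψ y = θ x) :
    ∃ φ : (Fin r → MvPolynomial (Fin n) K) →ₗ[MvPolynomial (Fin n) K]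
      (Fin s → MvPolynomial (Fin n) K), IsGraded w deg deg' φ ∧ ψ ∘ₗ φ = θ := by
  have hg : ∀ l, ∃ g ∈ freePart w deg' (deg l), ψ g = θ (Pi.single l 1) := fun l =>
    exists_homogeneous_preimage (ψ := ψ.restrictScalars K) (deg := deg') (𝓛 := 𝓛) (a := deg l)
      h𝓛 hψ (hθ _ _ (single_mem_freePart l)) (hr (Pi.single l 1))
  choose g hg1 hg2 using hg
  have hφ : ∀ l, (Pi.basisFun (MvPolynomial (Fin n) K) (Fin r)).constr ℕ g (Pi.single l 1) =
      g l := fun l => by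
    rw [← Pi.basisFun_apply, Module.Basis.constr_basis]
  refine ⟨(Pi.basisFun (MvPolynomial (Fin n) K) (Fin r)).constr ℕ g, ?_, ?_⟩
  · refine linearMap_mem_of_single (𝓛 := freePart w deg') (deg := deg)
      (fun c a q hq x hx => smul_mem_freePart hq hx) fun l => ?_
    rw [hφ]
    exact hg1 l
  · refine (Pi.basisFun (MvPolynomial (Fin n) K) (Fin r)).ext fun l => ?_
    rw [Pi.basisFun_apply, LinearMap.comp_apply, hφ, hg2]

end Graded

theorem exists_seq_of_step {X : ℕ → Type*} {R : ∀ i, X i → X (i + 1) → Prop} (x₀ : X 0)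
    (step : ∀ i x, ∃ y, R i x y) : ∃ f : ∀ i, X i, f 0 = x₀ ∧ ∀ i, R i (f i) (f (i + 1)) := by
  choose g hg using step
  exact ⟨fun i => Nat.rec x₀ (fun j x => g j x) i, rfl, fun i => hg i _⟩

/-! ### Reduction modulo the variables -/

section Bar

variable {K Γ : Type*} [Field K] [AddCommGroup Γ] {n r s t : ℕ}

/-- The map `φ ⊗_S K`. -/
noncomputable def bar (φ : (Fin r → MvPolynomial (Fin n) K) →ₗ[MvPolynomial (Fin n) K]
    (Fin s → MvPolynomial (Fin n) K)) : (Fin r → K) →ₗ[K] (Fin s → K) :=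
  Matrix.toLin' ((LinearMap.toMatrix' φ).map constantCoeff)

theorem bar_comp (ψ : (Fin s → MvPolynomial (Fin n) K) →ₗ[MvPolynomial (Fin n) K]
      (Fin t → MvPolynomial (Fin n) K))
    (φ : (Fin r → MvPolynomial (Fin n) K) →ₗ[MvPolynomial (Fin n) K]
      (Fin s → MvPolynomial (Fin n) K)) : bar (ψ ∘ₗ φ) = bar ψ ∘ₗ bar φ := by
  rw [bar, LinearMap.toMatrix'_comp, Matrix.map_mul, Matrix.toLin'_mul, bar, bar]

theorem bar_add (ψ φ : (Fin r → MvPolynomial (Fin n) K) →ₗ[MvPolynomial (Fin n) K]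
      (Fin s → MvPolynomial (Fin n) K)) : bar (ψ + φ) = bar ψ + bar φ := by
  rw [bar, map_add, Matrix.map_add _ (map_add _), map_add, bar, bar]

theorem bar_sub (ψ φ : (Fin r → MvPolynomial (Fin n) K) →ₗ[MvPolynomial (Fin n) K]
      (Fin s → MvPolynomial (Fin n) K)) : bar (ψ - φ) = bar ψ - bar φ := by
  rw [bar, map_sub, Matrix.map_sub _ (map_sub _), map_sub, bar, bar]

theorem bar_id : bar (LinearMap.id : (Fin r → MvPolynomial (Fin n) K) →ₗ[_] _) =
    LinearMap.id := by
  rw [bar, LinearMap.toMatrix'_id, Matrix.map_one _ (map_zero _) (map_one _), Matrix.toLin'_one]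

theorem constantCoeff_eq_zero_of_ne {w : Fin n → Γ} {q : MvPolynomial (Fin n) K} {c : Γ}
    (hq : IsWeightedHomogeneous w q c) (hc : c ≠ 0) : constantCoeff q = 0 := by
  by_contra h
  exact hc (by simpa using (hq (d := 0) h).symm)

theorem bar_apply_mem {w : Fin n → Γ} {deg : Fin r → Γ} {deg' : Fin s → Γ}
    {φ : (Fin r → MvPolynomial (Fin n) K) →ₗ[MvPolynomial (Fin n) K]
      (Fin s → MvPolynomial (Fin n) K)} (hφ : IsGraded w deg deg' φ) {a : Γ} {v : Fin r → K}
    (hv : ∀ l, deg l ≠ a → v l = 0) (l : Fin s) (hl : deg' l ≠ a) : bar φ v l = 0 := by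
  rw [bar, Matrix.toLin'_apply, Matrix.mulVec, dotProduct]
  refine Finset.sum_eq_zero fun j _ => ?_
  by_cases hj : deg j = a
  · have h := mem_freePart.1 (hφ _ _ (single_mem_freePart j)) l
    have h0 := constantCoeff_eq_zero_of_ne h (sub_ne_zero.2 (hj.trans_ne hl.symm))
    rw [Matrix.map_apply, LinearMap.toMatrix'_apply]
    convert zero_mul _
  · rw [hv j hj, mul_zero]

end Bar

/-! ### Comparison of resolutions and Betti numbers -/

namespace GradedFreeResolution

variable {K M Γ : Type*} [Field K] [AddCommGroup Γ] {n : ℕ}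
  [AddCommGroup M] [Module K M] [Module (MvPolynomial (Fin n) K) M]
  {w : Fin n → Γ} {𝓜 : Γ → Submodule K M}

theorem aug_d (F : GradedFreeResolution w 𝓜) (x) : F.aug (F.d 0 x) = 0 :=
  F.exact_zero.apply_apply_eq_zero x

theorem d_d (F : GradedFreeResolution w 𝓜) (i) (x) : F.d i (F.d (i + 1) x) = 0 :=
  (F.exact_succ i).apply_apply_eq_zero x

theorem exists_chainMap [IsScalarTower K (MvPolynomial (Fin n) K) M] (h𝓜 : HasProjections 𝓜)
    (F G : GradedFreeResolution w 𝓜) :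
    ∃ α : ∀ i, (Fin (F.rank i) → MvPolynomial (Fin n) K) →ₗ[MvPolynomial (Fin n) K]
      (Fin (G.rank i) → MvPolynomial (Fin n) K),
      (∀ i, IsGraded w (F.deg i) (G.deg i) (α i)) ∧ G.aug ∘ₗ α 0 = F.aug ∧
      ∀ i, G.d i ∘ₗ α (i + 1) = α i ∘ₗ F.d i := by
  obtain ⟨α₀, hα₀, hα₀'⟩ := exists_graded_lift h𝓜 G.aug_mem F.aug_mem
    fun x => G.aug_surjective _
  obtain ⟨f, hf0, hf⟩ := exists_seq_of_step
    -- The subtype carries the invariant that the next lift needs: `α ∘ d` lands in the image of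
    -- `G.d i`.
    (X := fun i => {α : (Fin (F.rank i) → MvPolynomial (Fin n) K) →ₗ[MvPolynomial (Fin n) K]
      (Fin (G.rank i) → MvPolynomial (Fin n) K) //
      IsGraded w (F.deg i) (G.deg i) α ∧ ∀ x, ∃ y, G.d i y = α (F.d i x)})
    (R := fun i α β => G.d i ∘ₗ β.1 = α.1 ∘ₗ F.d i)
    ⟨α₀, hα₀, fun x => (G.exact_zero _).1 (by
      rw [← LinearMap.comp_apply, hα₀', aug_d])⟩
    (by
      rintro i ⟨α, hα, hα'⟩
      obtain ⟨β, hβ, hβ'⟩ := exists_graded_lift hasProjections_freePart (G.d_mem i)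
        (θ := α ∘ₗ F.d i) (fun a f hf => hα _ _ (F.d_mem i a f hf)) hα'
      refine ⟨⟨β, hβ, fun x => (G.exact_succ i _).1 ?_⟩, hβ'⟩
      rw [← LinearMap.comp_apply, hβ', LinearMap.comp_apply, d_d, map_zero])
  refine ⟨fun i => (f i).1, fun i => (f i).2.1, ?_, hf⟩
  simpa only [hf0] using hα₀'

theorem exists_homotopy (F : GradedFreeResolution w 𝓜)
    (γ : ∀ i, (Fin (F.rank i) → MvPolynomial (Fin n) K) →ₗ[MvPolynomial (Fin n) K]
      (Fin (F.rank i) → MvPolynomial (Fin n) K))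
    (hγ : ∀ i, IsGraded w (F.deg i) (F.deg i) (γ i)) (hγ0 : F.aug ∘ₗ γ 0 = 0)
    (hγd : ∀ i, F.d i ∘ₗ γ (i + 1) = γ i ∘ₗ F.d i) :
    ∃ h : ∀ i, (Fin (F.rank i) → MvPolynomial (Fin n) K) →ₗ[MvPolynomial (Fin n) K]
      (Fin (F.rank (i + 1)) → MvPolynomial (Fin n) K),
      γ 0 = F.d 0 ∘ₗ h 0 ∧ ∀ i, γ (i + 1) = F.d (i + 1) ∘ₗ h (i + 1) + h i ∘ₗ F.d i := by
  obtain ⟨h₀, hh₀, hh₀'⟩ := exists_graded_lift hasProjections_freePart (F.d_mem 0) (hγ 0)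
    fun x => (F.exact_zero _).1 (LinearMap.congr_fun hγ0 x)
  obtain ⟨f, hf0, hf⟩ := exists_seq_of_step
    -- The invariant `d h d = γ d` says that `γ (i + 1) - h d` takes values in the cycles, so it
    -- lifts through `F.d (i + 1)`.
    (X := fun i => {h : (Fin (F.rank i) → MvPolynomial (Fin n) K) →ₗ[MvPolynomial (Fin n) K]
      (Fin (F.rank (i + 1)) → MvPolynomial (Fin n) K) //
      IsGraded w (F.deg i) (F.deg (i + 1)) h ∧ ∀ x, F.d i (h (F.d i x)) = γ i (F.d i x)})
    (R := fun i h h' => γ (i + 1) = F.d (i + 1) ∘ₗ h'.1 + h.1 ∘ₗ F.d i)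
    ⟨h₀, hh₀, fun x => LinearMap.congr_fun hh₀' _⟩
    (by
      rintro i ⟨h, hh, hh'⟩
      obtain ⟨h', hg, hg'⟩ := exists_graded_lift hasProjections_freePart (F.d_mem (i + 1))
        (θ := γ (i + 1) - h ∘ₗ F.d i) (fun a f hf => Submodule.sub_mem _ (hγ _ _ _ hf)
          (hh _ _ (F.d_mem i a f hf))) fun x => (F.exact_succ i _).1 (by
            have := LinearMap.congr_fun (hγd i) x
            simp only [LinearMap.comp_apply] at this
            simp only [LinearMap.sub_apply, LinearMap.comp_apply, map_sub, hh', this, sub_self])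
      refine ⟨⟨h', hg, fun x => ?_⟩, ?_⟩
      · have := LinearMap.congr_fun hg' (F.d (i + 1) x)
        simp only [LinearMap.sub_apply, LinearMap.comp_apply, d_d, map_zero, sub_zero] at this
        exact this
      · rw [hg', sub_add_cancel])
  exact ⟨fun i => (f i).1, by simpa only [hf0] using hh₀'.symm, hf⟩

theorem dBar_eq_zero {F : GradedFreeResolution w 𝓜}
    (hF : ∀ i x l, constantCoeff (F.d i x l) = 0) (i : ℕ) : F.dBar i = 0 := by
  rw [dBar, ← map_zero Matrix.toLin']
  congr 1
  ext l j
  simp [LinearMap.toMatrix'_apply, hF]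

/-- The Betti numbers of `M`, computed from any graded free resolution, are the numbers of basis
vectors of the given degree in a minimal one. -/
theorem betti_eq_card [IsScalarTower K (MvPolynomial (Fin n) K) M] [DecidableEq Γ]
    (h𝓜 : HasProjections 𝓜) (F G : GradedFreeResolution w 𝓜)
    (hF : ∀ i x l, constantCoeff (F.d i x l) = 0) (i : ℕ) (a : Γ) :
    G.betti i a = Fintype.card {l // F.deg i l = a} := by
  obtain ⟨α, hα, hα0, hαd⟩ := exists_chainMap h𝓜 F G
  obtain ⟨β, hβ, hβ0, hβd⟩ := exists_chainMap h𝓜 G F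
  obtain ⟨h, hh0, hh⟩ := F.exists_homotopy (fun i => β i ∘ₗ α i - LinearMap.id)
    (fun i a f hf => Submodule.sub_mem _ (hβ _ _ _ (hα _ _ _ hf)) hf)
    (by rw [LinearMap.comp_sub, ← LinearMap.comp_assoc, hβ0, hα0, LinearMap.comp_id, sub_self])
    (fun i => by rw [LinearMap.comp_sub, ← LinearMap.comp_assoc, hβd, LinearMap.comp_assoc, hαd,
      LinearMap.sub_comp, LinearMap.comp_id, LinearMap.id_comp, LinearMap.comp_assoc])
  obtain ⟨h', hh0', hh'⟩ := G.exists_homotopy (fun i => α i ∘ₗ β i - LinearMap.id)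
    (fun i a f hf => Submodule.sub_mem _ (hα _ _ _ (hβ _ _ _ hf)) hf)
    (by rw [LinearMap.comp_sub, ← LinearMap.comp_assoc, hα0, hβ0, LinearMap.comp_id, sub_self])
    (fun i => by rw [LinearMap.comp_sub, ← LinearMap.comp_assoc, hαd, LinearMap.comp_assoc, hβd,
      LinearMap.sub_comp, LinearMap.comp_id, LinearMap.id_comp, LinearMap.comp_assoc])
  have hd : ∀ i, bar (F.d i) = 0 := dBar_eq_zero hF
  -- The homotopy terms on `F` contain a differential of `F`, which reduces to zero.
  have hβα : ∀ v, bar (β i) (bar (α i) v) = v := by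
    intro v
    have : bar (β i ∘ₗ α i - LinearMap.id) = 0 := by
      cases i with
      | zero => rw [hh0, bar_comp, hd, LinearMap.zero_comp]
      | succ i => rw [hh, bar_add, bar_comp, bar_comp, hd, hd, LinearMap.zero_comp,
          LinearMap.comp_zero, add_zero]
    rw [bar_sub, bar_comp, bar_id, sub_eq_zero] at this
    exact LinearMap.congr_fun this v
  have hαβ : ∀ v ∈ G.cycles i, ∃ u, bar (α i) (bar (β i) v) - v = G.dBar i u := by
    intro v hv
    have e : bar (α i) (bar (β i) v) - v = bar (α i ∘ₗ β i - LinearMap.id) v := by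
      rw [bar_sub, bar_comp, bar_id]; rfl
    rw [e]
    refine ⟨bar (h' i) v, ?_⟩
    cases i with
    | zero => rw [hh0', bar_comp]; rfl
    | succ i =>
      have hv' : bar (G.d i) v = 0 := hv
      rw [hh', bar_add, bar_comp, bar_comp, LinearMap.add_apply, LinearMap.comp_apply,
        LinearMap.comp_apply, hv', map_zero, add_zero]
      rfl
  have hcyc : ∀ v, bar (α i) v ∈ G.cycles i := by
    intro v
    cases i with
    | zero => trivial
    | succ i =>
      have := congrArg bar (hαd i)
      rw [bar_comp, bar_comp, hd, LinearMap.comp_zero] at this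
      exact LinearMap.congr_fun this v
  have hbd : ∀ u, bar (β i) (G.dBar i u) = 0 := by
    intro u
    have := congrArg bar (hβd i)
    rw [bar_comp, bar_comp, hd, LinearMap.zero_comp] at this
    exact (LinearMap.congr_fun this u).symm
  -- This map is onto with kernel the boundaries, so it identifies `Tor` with the degree `a` part of
  -- the reduction of `Fᵢ`.
  let B : ↥(G.cycles i ⊓ G.barPart i a) →ₗ[K] F.barPart i a :=
    ((bar (β i)).domRestrict _).codRestrict _ fun v => bar_apply_mem (hβ i) v.2.2
  have hBs : Function.Surjective B := by
    rintro ⟨v, hv⟩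
    exact ⟨⟨bar (α i) v, hcyc v, bar_apply_mem (hα i) hv⟩, Subtype.ext (hβα v)⟩
  have hBk : LinearMap.ker B =
      (G.boundaries i ⊓ G.barPart i a).submoduleOf (G.cycles i ⊓ G.barPart i a) := by
    ext ⟨v, hv⟩
    rw [LinearMap.mem_ker, Submodule.submoduleOf, Submodule.mem_comap]
    constructor
    · intro h
      have h : bar (β i) v = 0 := congrArg Subtype.val h
      obtain ⟨u, hu⟩ := hαβ v hv.1
      rw [h, map_zero, zero_sub] at hu
      exact ⟨⟨-u, by rw [map_neg, ← hu, neg_neg]; rfl⟩, hv.2⟩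
    · rintro ⟨⟨u, hu⟩, -⟩
      refine Subtype.ext ?_
      change bar (β i) v = 0
      have hu : G.dBar i u = v := hu
      rw [← hu, hbd]
  change Module.finrank K (_ ⧸ _) = _
  rw [← hBk, (B.quotKerEquivOfSurjective hBs).finrank_eq]
  let E : F.barPart i a ≃ₗ[K] ({l // F.deg i l = a} → K) :=
    { toFun := fun v l => v.1 l.1
      map_add' := fun _ _ => rfl
      map_smul' := fun _ _ => rfl
      invFun := fun u => ⟨fun l => if h : F.deg i l = a then u ⟨l, h⟩ else 0, fun l hl => by
        simp [hl]⟩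
      left_inv := by
        rintro ⟨v, hv⟩
        ext l
        by_cases h : F.deg i l = a
        · simp [h]
        · simp [h, hv l h]
      right_inv := by
        intro u
        ext ⟨l, hl⟩
        simp [hl] }
  rw [E.finrank_eq, Module.finrank_fintype_fun_eq_card]

end GradedFreeResolution

end LinearStrand

namespace LinearStrand

/-! ### From the fine grading to the total degree -/

section Coarsening

variable {K M : Type*} [Field K] [AddCommGroup M] [Module K M] {n : ℕ}

theorem weight_fineWeight (m : Fin n →₀ ℕ) (v : Fin n) :
    Finsupp.weight (fineWeight n) m v = m v := by
  rw [Finsupp.weight_apply, Finsupp.sum_fintype _ _ (by simp)]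
  simp [fineWeight, Finset.sum_apply, Pi.single_apply]

theorem weight_stdWeight (m : Fin n →₀ ℕ) :
    Finsupp.weight (stdWeight n) m = ∑ v, (m v : ℤ) := by
  rw [Finsupp.weight_apply, Finsupp.sum_fintype _ _ (by simp)]
  simp [stdWeight]

theorem isWeightedHomogeneous_stdWeight {q : MvPolynomial (Fin n) K} {c : Fin n → ℤ}
    (hq : IsWeightedHomogeneous (fineWeight n) q c) :
    IsWeightedHomogeneous (stdWeight n) q (∑ v, c v) := by
  intro m hm
  rw [weight_stdWeight, ← hq hm]
  simp only [weight_fineWeight]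

theorem mem_coarsening {𝓜 : (Fin n → ℤ) → Submodule K M} {a : Fin n → ℤ} {x : M}
    (hx : x ∈ 𝓜 a) : x ∈ coarsening 𝓜 (∑ v, a v) :=
  Submodule.mem_iSup_of_mem a (Submodule.mem_iSup_of_mem rfl hx)

theorem coarsening_le {𝓜 : (Fin n → ℤ) → Submodule K M} {d : ℤ} {P : Submodule K M}
    (h : ∀ a, ∑ v, a v = d → 𝓜 a ≤ P) : coarsening 𝓜 d ≤ P :=
  iSup₂_le h

theorem hasProjections_coarsening (𝓜 : (Fin n → ℤ) → Submodule K M)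
    [DirectSum.Decomposition 𝓜] : HasProjections (coarsening 𝓜) := by
  let π : ℤ → M →ₗ[K] M := fun d =>
    DirectSum.toModule K _ M (fun a => if ∑ v, a v = d then (𝓜 a).subtype else 0) ∘ₗ
      (DirectSum.decomposeLinearEquiv 𝓜).toLinearMap
  have hπ : ∀ d a x, x ∈ 𝓜 a → π d x = if ∑ v, a v = d then x else 0 := by
    intro d a x hx
    have : DirectSum.decomposeLinearEquiv 𝓜 x = DirectSum.lof K _ _ a ⟨x, hx⟩ :=
      DirectSum.decompose_of_mem 𝓜 hx
    simp only [π, LinearMap.comp_apply, LinearEquiv.coe_coe, this, DirectSum.toModule_lof]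
    split_ifs <;> rfl
  refine ⟨π, fun d => ?_, fun d e hde => ?_⟩
  · have h : coarsening 𝓜 d ≤ LinearMap.eqLocus (π d) LinearMap.id :=
      coarsening_le fun a ha x hx => by
        rw [LinearMap.mem_eqLocus, hπ d a x hx, if_pos ha, LinearMap.id_apply]
    exact fun x hx => h hx
  · have h : coarsening 𝓜 e ≤ LinearMap.ker (π d) :=
      coarsening_le fun a ha x hx => by
        rw [LinearMap.mem_ker, hπ d a x hx, if_neg (ha.trans_ne hde.symm)]
    exact fun x hx => h hx

variable [Module (MvPolynomial (Fin n) K) M] [IsScalarTower K (MvPolynomial (Fin n) K) M]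

/-- A polynomial homogeneous for the total degree need not be so for the fine grading, but each of
its monomials is. -/
theorem smul_mem_coarsening {𝓜 : (Fin n → ℤ) → Submodule K M}
    [SetLike.GradedSMul (weightedHomogeneousSubmodule K (fineWeight n)) 𝓜] (c a : ℤ)
    (q : MvPolynomial (Fin n) K) (hq : IsWeightedHomogeneous (stdWeight n) q c) (x : M)
    (hx : x ∈ coarsening 𝓜 a) : q • x ∈ coarsening 𝓜 (c + a) := by
  rw [q.as_sum, Finset.sum_smul]
  refine Submodule.sum_mem _ fun m hm => ?_
  have h : coarsening 𝓜 a ≤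
      (coarsening 𝓜 (c + a)).comap (Algebra.lsmul K K M (monomial m (coeff m q))) := by
    refine coarsening_le fun b hb y hy => ?_
    have h1 : monomial m (coeff m q) • y ∈ 𝓜 (Finsupp.weight (fineWeight n) m +ᵥ b) :=
      SetLike.GradedSMul.smul_mem (A := weightedHomogeneousSubmodule K (fineWeight n))
        (isWeightedHomogeneous_monomial (fineWeight n) m _ rfl) hy
    have h2 := mem_coarsening h1
    simp only [vadd_eq_add, Pi.add_apply, Finset.sum_add_distrib, weight_fineWeight, hb] at h2
    rw [← weight_stdWeight, hq (mem_support_iff.1 hm)] at h2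
    exact h2
  exact h hx

end Coarsening

theorem exists_factorization {R A B C : Type*} [Ring R] [AddCommGroup A] [AddCommGroup B]
    [AddCommGroup C] [Module R A] [Module R B] [Module R C] {φ : B →ₗ[R] C}
    (hφ : Function.Injective φ) (θ : A →ₗ[R] C) (h : LinearMap.range θ ≤ LinearMap.range φ) :
    ∃ ψ : A →ₗ[R] B, ∀ x, φ (ψ x) = θ x := by
  refine ⟨(LinearEquiv.ofInjective φ hφ).symm.toLinearMap ∘ₗ
    θ.codRestrict (LinearMap.range φ) fun x => h ⟨x, rfl⟩, fun x => ?_⟩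
  exact congrArg Subtype.val ((LinearEquiv.ofInjective φ hφ).apply_symm_apply
    (θ.codRestrict (LinearMap.range φ) (fun x => h ⟨x, rfl⟩) x))

namespace GradedFreeResolution

/-! ### Minimality and the initial degree -/

section Minimal

variable {K M Γ : Type*} [Field K] [AddCommGroup Γ] {n : ℕ}
  [AddCommGroup M] [Module K M] [Module (MvPolynomial (Fin n) K) M]
  {w : Fin n → Γ} {𝓜 : Γ → Submodule K M}

theorem IsMinimal.constantCoeff_d {F : GradedFreeResolution w 𝓜} (hF : F.IsMinimal) (i x l) :
    constantCoeff (F.d i x l) = 0 := by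
  have h := hF i ⟨x, rfl⟩
  have hI : Ideal.span (Set.range (X : Fin n → MvPolynomial (Fin n) K)) ≤
      RingHom.ker (constantCoeff (R := K)) := by
    rw [Ideal.span_le]
    rintro _ ⟨v, rfl⟩
    simp
  have h2 : ∀ y ∈ Ideal.span (Set.range (X : Fin n → MvPolynomial (Fin n) K)) •
      (⊤ : Submodule (MvPolynomial (Fin n) K) (Fin (F.rank i) → MvPolynomial (Fin n) K)),
      constantCoeff (y l) = 0 := by
    intro y hy
    refine Submodule.smul_induction_on hy (fun q hq z _ => ?_) fun y z hy hz => ?_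
    · rw [Pi.smul_apply, smul_eq_mul, map_mul, RingHom.mem_ker.1 (hI hq), zero_mul]
    · rw [Pi.add_apply, map_add, hy, hz, add_zero]
  exact h2 _ h

/-- Otherwise exactness makes the basis vector a boundary, although it has a coordinate with
constant term `1`. -/
theorem aug_single_ne_zero {F : GradedFreeResolution w 𝓜}
    (hF : ∀ i x l, constantCoeff (F.d i x l) = 0) (l : Fin (F.rank 0)) :
    F.aug (Pi.single l 1) ≠ 0 := by
  intro h
  obtain ⟨y, hy⟩ := (F.exact_zero _).1 h
  simpa [hy] using hF 0 y l

theorem d_single_ne_zero {F : GradedFreeResolution w 𝓜}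
    (hF : ∀ i x l, constantCoeff (F.d i x l) = 0) (i : ℕ) (l : Fin (F.rank (i + 1))) :
    F.d i (Pi.single l 1) ≠ 0 := by
  intro h
  obtain ⟨y, hy⟩ := (F.exact_succ i _).1 h
  simpa [hy] using hF (i + 1) y l

end Minimal

section InitialDegree

variable {K M : Type*} [Field K] {n : ℕ}
  [AddCommGroup M] [Module K M] [Module (MvPolynomial (Fin n) K) M]
  {𝓜 : ℤ → Submodule K M}

/-- Without a lower bound the `sInf` in `initialDegree` would be the default value `0`. The bound is
the least degree of a generator in `F₀`. -/
theorem bddBelow_degrees [IsScalarTower K (MvPolynomial (Fin n) K) M] (h𝓜 : HasProjections 𝓜)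
    (F : GradedFreeResolution (stdWeight n) 𝓜) : BddBelow {d : ℤ | 𝓜 d ≠ ⊥} := by
  obtain ⟨b, hb⟩ := (Set.finite_range (F.deg 0)).bddBelow
  refine ⟨b, fun d hd => ?_⟩
  obtain ⟨x, hx, hx0⟩ := Submodule.exists_mem_ne_zero_of_ne_bot hd
  obtain ⟨f, hf, rfl⟩ := exists_homogeneous_preimage (ψ := F.aug.restrictScalars K) h𝓜
    F.aug_mem hx (F.aug_surjective x)
  have hf0 : f ≠ 0 := by
    rintro rfl
    exact hx0 (map_zero _)
  obtain ⟨l, hl⟩ := Function.ne_iff.1 hf0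
  obtain ⟨m, hm⟩ := exists_coeff_ne_zero hl
  have h1 := mem_freePart.1 hf l hm
  rw [weight_stdWeight] at h1
  have h2 : 0 ≤ ∑ v, (m v : ℤ) := Finset.sum_nonneg fun v _ => Int.natCast_nonneg _
  have h3 := hb ⟨l, rfl⟩
  linarith

/-- Each differential of a basis vector is nonzero with entries free of constant terms, so degrees
rise by at least one per step. The linear strand is therefore the lowest possible one. -/
theorem initialDegree_add_le_deg [IsScalarTower K (MvPolynomial (Fin n) K) M]
    (h𝓜 : HasProjections 𝓜) {F : GradedFreeResolution (stdWeight n) 𝓜}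
    (hF : ∀ i x l, constantCoeff (F.d i x l) = 0) (i : ℕ) (l : Fin (F.rank i)) :
    initialDegree 𝓜 + i ≤ F.deg i l := by
  induction i with
  | zero =>
    rw [Nat.cast_zero, add_zero]
    refine csInf_le (bddBelow_degrees h𝓜 F) fun h => aug_single_ne_zero hF l ?_
    have := F.aug_mem _ _ (single_mem_freePart l)
    rwa [h, Submodule.mem_bot] at this
  | succ i ih =>
    obtain ⟨l', hl'⟩ := Function.ne_iff.1 (d_single_ne_zero hF i l)
    obtain ⟨m, hm⟩ := exists_coeff_ne_zero hl'
    have h1 := mem_freePart.1 (F.d_mem i _ _ (single_mem_freePart l)) l' hm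
    rw [weight_stdWeight] at h1
    have hm0 : m ≠ 0 := by
      rintro rfl
      exact hm (hF i _ l')
    obtain ⟨v, hv⟩ := Finsupp.ne_iff.1 hm0
    have h2 : (m v : ℤ) ≤ ∑ v, (m v : ℤ) :=
      Finset.single_le_sum (f := fun v => (m v : ℤ)) (fun v _ => Int.natCast_nonneg _)
        (Finset.mem_univ v)
    have h3 : 1 ≤ (m v : ℤ) := by exact_mod_cast Nat.one_le_iff_ne_zero.2 hv
    have h4 := ih l'
    push_cast
    linarith

end InitialDegree

/-! ### The tail of the resolution as a resolution of the syzygy -/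

section Truncation

variable {K M N : Type*} [Field K] {n : ℕ}
  [AddCommGroup M] [Module K M] [Module (MvPolynomial (Fin n) K) M]
  [AddCommGroup N] [Module K N] [Module (MvPolynomial (Fin n) K) N]
  {𝓜 : (Fin n → ℤ) → Submodule K M} {𝓝 : (Fin n → ℤ) → Submodule K N}

theorem IsSyzygy.exists_augmentation {F : GradedFreeResolution (fineWeight n) 𝓝} {k : ℕ}
    (h : F.IsSyzygy 𝓜 k) :
    ∃ ε : (Fin (F.rank k) → MvPolynomial (Fin n) K) →ₗ[MvPolynomial (Fin n) K] M,
      Function.Surjective ε ∧ Function.Exact (F.d k) ε ∧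
      ∀ l, ε (Pi.single l 1) ∈ 𝓜 (F.deg k l) := by
  cases k with
  | zero =>
    obtain ⟨φ, hφ, hdeg⟩ := h
    obtain ⟨ε, hε⟩ := exists_factorization hφ.1 F.aug
      (by rw [LinearMap.range_eq_top.2 hφ.2]; exact le_top)
    refine ⟨ε, fun x => ?_, fun x => ?_, fun l => ?_⟩
    · obtain ⟨y, hy⟩ := F.aug_surjective (φ x)
      exact ⟨y, hφ.1 (by rw [hε, hy])⟩
    · rw [← F.exact_zero x, ← hε, map_eq_zero_iff φ hφ.1]
    · rw [hdeg, hε]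
      exact F.aug_mem _ _ (single_mem_freePart l)
  | succ k =>
    obtain ⟨φ, hφ, hr, hdeg⟩ := h
    obtain ⟨ε, hε⟩ := exists_factorization hφ (F.d k) hr.ge
    refine ⟨ε, fun x => ?_, fun x => ?_, fun l => ?_⟩
    · obtain ⟨y, hy⟩ := hr.le ⟨x, rfl⟩
      exact ⟨y, hφ (by rw [hε, hy])⟩
    · rw [← F.exact_succ k x, ← hε, map_eq_zero_iff φ hφ]
    · rw [hdeg, hε]
      exact F.d_mem _ _ _ (single_mem_freePart l)

/-- The part `⋯ → Fₖ₊₁ → Fₖ → M → 0` of a `ℤⁿ`-graded free resolution, as a `ℤ`-graded free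
resolution of `M`. -/
noncomputable def truncate [IsScalarTower K (MvPolynomial (Fin n) K) M]
    [SetLike.GradedSMul (weightedHomogeneousSubmodule K (fineWeight n)) 𝓜]
    (F : GradedFreeResolution (fineWeight n) 𝓝) (k : ℕ)
    (ε : (Fin (F.rank k) → MvPolynomial (Fin n) K) →ₗ[MvPolynomial (Fin n) K] M)
    (hs : Function.Surjective ε) (he : Function.Exact (F.d k) ε)
    (hε : ∀ l, ε (Pi.single l 1) ∈ 𝓜 (F.deg k l)) :
    GradedFreeResolution (stdWeight n) (coarsening 𝓜) where
  rank i := F.rank (k + i)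
  deg i l := ∑ v, F.deg (k + i) l v
  d i := F.d (k + i)
  aug := ε
  d_mem i := linearMap_mem_of_single (deg := fun l => ∑ v, F.deg (k + (i + 1)) l v)
    (𝓛 := freePart (stdWeight n) fun l => ∑ v, F.deg (k + i) l v)
    (fun _ _ _ hq _ hx => smul_mem_freePart hq hx) fun l =>
    mem_freePart.2 fun l' => by
      have := isWeightedHomogeneous_stdWeight
        (mem_freePart.1 (F.d_mem (k + i) _ _ (single_mem_freePart l)) l')
      simp only [Pi.sub_apply, Finset.sum_sub_distrib] at this
      exact this
  aug_mem := linearMap_mem_of_single (𝓛 := coarsening 𝓜) smul_mem_coarsening fun l =>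
    mem_coarsening (hε l)
  aug_surjective := hs
  exact_zero := he
  exact_succ i := F.exact_succ (k + i)

end Truncation

/-! ### Vanishing of Tor against quotients by variables -/

section Vanishing

variable {K M Γ : Type*} [Field K] [AddCommGroup Γ] {n : ℕ}
  [AddCommGroup M] [Module K M] [Module (MvPolynomial (Fin n) K) M]
  {w : Fin n → Γ} {𝓜 : Γ → Submodule K M}

/-- Membership asks every monomial for a positive exponent at some index of `J`, and multiplication
by `X v` changes only the exponent at `v`. -/
theorem mem_span_X_of_X_mul_mem {J : Set (Fin n)} {v : Fin n} (hv : v ∉ J)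
    {q : MvPolynomial (Fin n) K} (h : X v * q ∈ Ideal.span (X '' J)) :
    q ∈ Ideal.span (X '' J : Set (MvPolynomial (Fin n) K)) := by
  rw [mem_ideal_span_X_image] at h ⊢
  intro m hm
  obtain ⟨u, hu, hu'⟩ := h (Finsupp.single v 1 + m) (by
    rw [mem_support_iff, coeff_X_mul]
    exact mem_support_iff.1 hm)
  refine ⟨u, hu, ?_⟩
  have : v ≠ u := fun h => hv (h ▸ hu)
  simpa [Finsupp.single_apply, this] using hu'

theorem apply_mem_ideal {R : Type*} [CommRing R] {r s : ℕ} (φ : (Fin r → R) →ₗ[R] (Fin s → R))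
    {I : Ideal R} {f : Fin r → R} (hf : ∀ l, f l ∈ I) (l : Fin s) : φ f l ∈ I := by
  rw [LinearMap.pi_apply_eq_sum_univ φ f, Finset.sum_apply]
  exact Ideal.sum_mem _ fun j _ => I.mul_mem_right _ (hf j)

/-- `Tor_{i+1}(M, S/(x_v : v ∈ J)) = 0` for `|J| ≤ i`. -/
theorem exists_sub_d_mem_span_X (F : GradedFreeResolution w 𝓜) (J : Finset (Fin n)) (i : ℕ)
    (hJ : J.card ≤ i) (f : Fin (F.rank (i + 1)) → MvPolynomial (Fin n) K)
    (hf : ∀ l, F.d i f l ∈ Ideal.span (X '' (J : Set (Fin n)))) :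
    ∃ g, ∀ l, (f - F.d (i + 1) g) l ∈
      Ideal.span (X '' (J : Set (Fin n)) : Set (MvPolynomial (Fin n) K)) := by
  -- This is the long exact sequence of multiplication by `X v` on `S/(x_u : u ∈ J)`, done by hand;
  -- it needs the claim for `J` in two consecutive homological degrees.
  induction J using Finset.induction_on generalizing i f with
  | empty =>
    simp only [Finset.coe_empty, Set.image_empty, Ideal.span_empty, Ideal.mem_bot] at hf ⊢
    obtain ⟨g, hg⟩ := (F.exact_succ i f).1 (funext hf)
    exact ⟨g, fun l => by rw [hg, sub_self, Pi.zero_apply]⟩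
  | insert v J hv ih =>
    rw [Finset.card_insert_of_notMem hv] at hJ
    obtain ⟨i, rfl⟩ : ∃ j, i = j + 1 := ⟨i - 1, by omega⟩
    rw [Finset.coe_insert, Set.image_insert_eq] at hf ⊢
    simp only [Ideal.mem_span_insert] at hf
    choose g q hq hfg using hf
    have hdf : F.d (i + 1) f = (X v : MvPolynomial (Fin n) K) • g + q := by
      funext l
      rw [hfg, mul_comm]
      rfl
    -- Applying `d` to `d f = X v • g + q` shows that `X v • d g` lies in the ideal of `J`, and `X
    -- v` cancels.
    have hg : ∀ l, F.d i g l ∈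
        Ideal.span (X '' (J : Set (Fin n)) : Set (MvPolynomial (Fin n) K)) := by
      intro l
      refine mem_span_X_of_X_mul_mem (v := v) (J := (J : Set (Fin n))) (by simpa using hv) ?_
      have h0 := congrFun (F.d_d i f) l
      rw [hdf, map_add, map_smul] at h0
      rw [← smul_eq_mul, ← Pi.smul_apply, eq_neg_of_add_eq_zero_left h0]
      exact neg_mem (apply_mem_ideal _ hq l)
    obtain ⟨h, hh⟩ := ih i (by omega) g hg
    obtain ⟨g', hg'⟩ := ih (i + 1) (by omega) (f - (X v : MvPolynomial (Fin n) K) • h) (by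
      intro l
      have : F.d (i + 1) (f - (X v : MvPolynomial (Fin n) K) • h) =
          (X v : MvPolynomial (Fin n) K) • (g - F.d (i + 1) h) + q := by
        rw [map_sub, map_smul, hdf, smul_sub]
        abel
      rw [this]
      exact add_mem (Ideal.mul_mem_left _ _ (hh l)) (hq l))
    refine ⟨g', fun l => Ideal.mem_span_insert.2 ⟨h l, _, hg' l, ?_⟩⟩
    simp only [Pi.sub_apply, Pi.smul_apply, smul_eq_mul]
    ring

end Vanishing

/-! ### Lower neighbours of a multidegree on the linear strand -/

section Neighbours

variable {K M : Type*} [Field K] {n : ℕ}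
  [AddCommGroup M] [Module K M] [Module (MvPolynomial (Fin n) K) M]
  {𝓜 : (Fin n → ℤ) → Submodule K M}

/-- With too few neighbours, Tor vanishing makes the basis vector a boundary modulo variables, and
comparing constant terms gives `1 = 0`. -/
theorem lt_card_neighbours {F : GradedFreeResolution (fineWeight n) 𝓜} (hF : F.IsMinimal)
    (i : ℕ) (l : Fin (F.rank (i + 1)))
    (hl : ∀ l', ∑ v, F.deg (i + 1) l v - 1 ≤ ∑ v, F.deg i l' v) :
    i < (Finset.univ.filter fun v : Fin n =>
      F.deg (i + 1) l - Pi.single v 1 ∈ Finset.univ.image (F.deg i)).card := by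
  set J := Finset.univ.filter fun v : Fin n =>
      F.deg (i + 1) l - Pi.single v 1 ∈ Finset.univ.image (F.deg i) with hJ
  by_contra hcard
  obtain ⟨g, hg⟩ := F.exists_sub_d_mem_span_X J i (not_lt.1 hcard) (Pi.single l 1) (by
    intro l'
    rw [mem_ideal_span_X_image]
    intro m hm
    have hm := mem_support_iff.1 hm
    have h1 := mem_freePart.1 (F.d_mem i _ _ (single_mem_freePart l)) l' hm
    have hm0 : m ≠ 0 := by
      rintro rfl
      exact hm (hF.constantCoeff_d i _ l')
    obtain ⟨v, hv⟩ := Finsupp.ne_iff.1 hm0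
    have h2 : ∀ u, (m u : ℤ) = F.deg (i + 1) l u - F.deg i l' u := fun u => by
      rw [← weight_fineWeight, h1, Pi.sub_apply]
    have h3 : ∑ u, (m u : ℤ) ≤ 1 := by
      simp only [h2, Finset.sum_sub_distrib]
      linarith [hl l']
    have h4 : ∀ u, (m u : ℤ) = (Pi.single v 1 : Fin n → ℤ) u := by
      have h5 := Finset.add_sum_erase Finset.univ (fun u => (m u : ℤ)) (Finset.mem_univ v)
      have hv' : 1 ≤ (m v : ℤ) := by exact_mod_cast Nat.one_le_iff_ne_zero.2 hv
      have h6 : ∀ u ∈ Finset.univ.erase v, 0 ≤ (m u : ℤ) := fun u _ => Int.natCast_nonneg _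
      have h7 := Finset.sum_nonneg h6
      intro u
      by_cases hu : u = v
      · subst hu
        rw [Pi.single_eq_same]
        linarith
      · rw [Pi.single_eq_of_ne hu]
        exact (Finset.sum_eq_zero_iff_of_nonneg h6).1 (by linarith) u
          (Finset.mem_erase.2 ⟨hu, Finset.mem_univ u⟩)
    refine ⟨v, ?_, hv⟩
    rw [hJ, Finset.coe_filter]
    refine ⟨Finset.mem_univ v, Finset.mem_image.2 ⟨l', Finset.mem_univ l', ?_⟩⟩
    funext u
    rw [Pi.sub_apply, ← h4, h2, sub_sub_cancel])
  have hI : Ideal.span (X '' (J : Set (Fin n)) : Set (MvPolynomial (Fin n) K)) ≤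
      RingHom.ker (constantCoeff (R := K)) := by
    rw [Ideal.span_le]
    rintro _ ⟨v, -, rfl⟩
    simp
  have h := RingHom.mem_ker.1 (hI (hg l))
  rw [Pi.sub_apply, map_sub, hF.constantCoeff_d, Pi.single_eq_same, map_one, sub_zero] at h
  exact one_ne_zero h

end Neighbours

end GradedFreeResolution

/-! ### Double counting of multidegrees -/

section Counting

variable {n : ℕ}

theorem card_filter_lt_le {a c : Fin n → ℤ} (h : c ≤ a) {j : ℕ} (hj : ∑ v, c v = ∑ v, a v - j) :
    (Finset.univ.filter fun v => c v < a v).card ≤ j := by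
  have h1 : ((Finset.univ.filter fun v => c v < a v).card : ℤ) ≤ ∑ v, (a v - c v) := by
    rw [Finset.card_filter, Nat.cast_sum]
    refine Finset.sum_le_sum fun v _ => ?_
    have : c v ≤ a v := h v
    split_ifs <;> push_cast <;> omega
  rw [Finset.sum_sub_distrib, hj, sub_sub_cancel] at h1
  exact_mod_cast h1

theorem choose_le_card_of_neighbours (D : ℕ → Finset (Fin n → ℤ)) {q p : ℕ} {a : Fin n → ℤ}
    (ha : a ∈ D 0)
    (h : ∀ j < p, ∀ b ∈ D j, ∑ v, b v = ∑ v, a v - j →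
      q - j ≤ (Finset.univ.filter fun v : Fin n => b - Pi.single v 1 ∈ D (j + 1)).card)
    (j : ℕ) (hj : j ≤ p) :
    q.choose j ≤ ((D j).filter fun b => (∀ v, b v ≤ a v) ∧ ∑ v, b v = ∑ v, a v - j).card := by
  induction j with
  | zero =>
    rw [Nat.choose_zero_right, Nat.one_le_iff_ne_zero, Finset.card_ne_zero]
    exact ⟨a, by simp [ha]⟩
  | succ j ih =>
    -- The factor `j + 1` turns the claim into the double count, by `(j + 1) * q.choose (j + 1) = (q
    -- - j) * q.choose j`.
    refine Nat.le_of_mul_le_mul_right ?_ j.succ_pos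
    rw [Nat.succ_eq_add_one, Nat.choose_succ_right_eq]
    refine (Nat.mul_le_mul_right _ (ih (by omega))).trans ?_
    refine Finset.card_mul_le_card_mul (fun b c => ∃ v, c + Pi.single v 1 = b) ?_ ?_
    · intro b hb
      obtain ⟨hbD, hba, hbs⟩ := Finset.mem_filter.1 hb
      refine (h j (by omega) b hbD hbs).trans ?_
      refine Finset.card_le_card_of_injOn (fun v => b - Pi.single v 1) ?_ ?_
      · intro v hv
        refine Finset.mem_filter.2 ⟨Finset.mem_filter.2
          ⟨(Finset.mem_filter.1 hv).2, ?_, ?_⟩, v, sub_add_cancel _ _⟩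
        · exact (sub_le_self b (Pi.single_nonneg.2 zero_le_one)).trans hba
        · simp only [Pi.sub_apply, Finset.sum_sub_distrib, hbs,
            Finset.sum_pi_single', Finset.mem_univ, if_true]
          push_cast
          ring
      · intro u _ v _ huv
        by_contra hne
        have := congrFun (sub_right_injective huv) u
        rw [Pi.single_eq_same, Pi.single_eq_of_ne hne] at this
        exact one_ne_zero this
    · intro c hc
      obtain ⟨hcD, hca, hcs⟩ := Finset.mem_filter.1 hc
      refine le_trans ?_ (card_filter_lt_le hca hcs)
      -- An upper neighbour `c + ε_v` stays below `a` only if `c v < a v`.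
      refine (Finset.card_le_card fun b hb => ?_).trans
        (Finset.card_image_le (f := fun v => c + Pi.single v 1))
      obtain ⟨hb, v, rfl⟩ := Finset.mem_filter.1 hb
      refine Finset.mem_image.2 ⟨v, Finset.mem_filter.2 ⟨Finset.mem_univ v, ?_⟩, rfl⟩
      have := (Finset.mem_filter.1 hb).2.1 v
      rw [Pi.add_apply, Pi.single_eq_same] at this
      omega

end Counting

end LinearStrand

/-- `F` is a minimal `ℤⁿ`-graded free resolution of `N`, and `M` is its `k`-th syzygy module. The
Betti numbers of `M` may be computed from any graded free resolution `G` of the `ℤ`-graded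
module `M`. -/
theorem corollary3p4 {K : Type*} [Field K] (n : ℕ)
    {M : Type*} [AddCommGroup M] [Module K M] [Module (MvPolynomial (Fin n) K) M]
    [IsScalarTower K (MvPolynomial (Fin n) K) M] [Module.Finite (MvPolynomial (Fin n) K) M]
    (𝓜 : (Fin n → ℤ) → Submodule K M) [DirectSum.Decomposition 𝓜]
    [SetLike.GradedSMul
      (MvPolynomial.weightedHomogeneousSubmodule K (LinearStrand.fineWeight n)) 𝓜]
    {N : Type*} [AddCommGroup N] [Module K N] [Module (MvPolynomial (Fin n) K) N]
    [IsScalarTower K (MvPolynomial (Fin n) K) N] [Module.Finite (MvPolynomial (Fin n) K) N]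
    (𝓝 : (Fin n → ℤ) → Submodule K N) [DirectSum.Decomposition 𝓝]
    [SetLike.GradedSMul
      (MvPolynomial.weightedHomogeneousSubmodule K (LinearStrand.fineWeight n)) 𝓝]
    (F : LinearStrand.GradedFreeResolution (LinearStrand.fineWeight n) 𝓝) (hF : F.IsMinimal)
    (k : ℕ) (hM : F.IsSyzygy 𝓜 k)
    (G : LinearStrand.GradedFreeResolution (LinearStrand.stdWeight n)
      (LinearStrand.coarsening 𝓜))
    (p : ℕ) (hp : G.linBetti p ≠ 0) :
    ∀ i ≤ p, (p + k).choose (i + k) ≤ G.linBetti i := by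
  classical
  obtain ⟨ε, hs, he, hε⟩ := hM.exists_augmentation
  have hproj := LinearStrand.hasProjections_coarsening 𝓜
  set R := F.truncate k ε hs he hε
  have hRmin : ∀ i x l, constantCoeff (R.d i x l) = 0 := fun i => hF.constantCoeff_d (k + i)
  have hcard : ∀ i, G.linBetti i = Fintype.card
      {l : Fin (F.rank (k + i)) // ∑ v, F.deg (k + i) l v =
        i + LinearStrand.initialDegree (LinearStrand.coarsening 𝓜)} := fun i =>
    LinearStrand.GradedFreeResolution.betti_eq_card hproj R G hRmin i _
  have hdeg : ∀ i (l : Fin (F.rank (k + i))),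
      LinearStrand.initialDegree (LinearStrand.coarsening 𝓜) + i ≤ ∑ v, F.deg (k + i) l v :=
    LinearStrand.GradedFreeResolution.initialDegree_add_le_deg hproj hRmin
  generalize LinearStrand.initialDegree (LinearStrand.coarsening 𝓜) = d at hcard hdeg
  intro i hi
  rw [hcard, ← Nat.pos_iff_ne_zero, Fintype.card_pos_iff] at hp
  obtain ⟨l₀, hl₀⟩ := hp
  -- Only distinct multidegrees are counted, which bounds the number of basis vectors from below.
  let D : ℕ → Finset (Fin n → ℤ) := fun m => Finset.univ.image (F.deg m)
  have hcount := LinearStrand.choose_le_card_of_neighbours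
    (fun j => D (k + (p - j))) (q := p + k) (p := p)
    (a := F.deg (k + p) l₀) (Finset.mem_image_of_mem _ (Finset.mem_univ l₀)) (by
      intro j hj b hb hbs
      obtain ⟨m, rfl⟩ : ∃ m, p = m + (j + 1) := ⟨p - (j + 1), by omega⟩
      have e1 : m + (j + 1) - j = m + 1 := by omega
      have e2 : m + (j + 1) - (j + 1) = m := by omega
      simp only [e1, e2] at hb ⊢
      obtain ⟨l, -, rfl⟩ := Finset.mem_image.1 hb
      -- The total degree of `l` is `d + m + 1`, and every degree of `F` at `k + m` is at least `d +
      -- m`. The result is at least `k + m + 1 = p + k - j` neighbours.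
      have := LinearStrand.GradedFreeResolution.lt_card_neighbours hF (k + m) l (by
        intro l'
        have h1 := hdeg m l'
        have h2 : ∑ v, F.deg (k + m + 1) l v = _ := hbs
        rw [h2, hl₀]
        push_cast
        linarith)
      exact le_trans (by omega) this) (p - i) (by omega)
  have hsymm : (p + k).choose (p - i) = (p + k).choose (i + k) := by
    rw [← Nat.choose_symm (by omega : i + k ≤ p + k)]
    congr 1
    omega
  simp only [hsymm, show p - (p - i) = i by omega, hl₀] at hcount
  rw [hcard, Fintype.card_subtype]
  refine hcount.trans ((Finset.card_le_card fun b hb => ?_).trans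
    (Finset.card_image_le (f := F.deg (k + i))))
  obtain ⟨hb, -, hbs⟩ := Finset.mem_filter.1 hb
  obtain ⟨l, -, rfl⟩ := Finset.mem_image.1 hb
  refine Finset.mem_image.2 ⟨l, Finset.mem_filter.2 ⟨Finset.mem_univ l, ?_⟩, rfl⟩
  rw [hbs]
  push_cast [Nat.cast_sub hi]
  ring
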